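/- Let $n\ge 1$ be an integer and let $1\le q<p<\infty$. For a measurable function $f:\mathbb{R}^n\to\mathbb{R}$ and $1\le r<\infty$ put \[ \|f\|_{L^{r,\infty}}:=\inf\Big\{C>0:\ \big|\{x\in\mathbb{R}^n:|f(x)|>\alpha\}\big|\le \frac{C^r}{\alpha^r}\ \text{ for all }\alpha>0\Big\}\in[0,\infty], \] where $|E|$ denotes the Lebesgue measure of $E$, and let $L^{r,\infty}(\mathbb{R}^n)$ be the set of measurable $f$ for which this is finite. Let $\mathrm{BMO}(\mathbb{R}^n)$ be the set of locally integrable $f:\mathbb{R}^n\to\mathbb{R}$ for which \[ \|f\|_{\mathrm{BMO}}:=\sup_Q\frac1{|Q|}\int_Q|f(x)-f_Q|\,dx,\qquad f_Q:=\frac1{|Q|}\int_Q f(y)\,dy, \] is finite, the supremum being over all cubes $Q\subset\mathbb{R}^n$ of positive side length with sides parallel to the coordinate axes. Then there is a constant $c=c(n,p,q)<\infty$ such that every $f\in L^{q,\infty}(\mathbb{R}^n)\cap\mathrm{BMO}(\mathbb{R}^n)$ belongs to $L^{p,\infty}(\mathbb{R}^n)$ and satisfies \[ \|f\|_{L^{p,\infty}}\le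 c\,\|f\|_{L^{q,\infty}}^{q/p}\,\|f\|_{\mathrm{BMO}}^{1-q/p}. \] -/

import Mathlib

open MeasureTheory Set
open scoped ENNReal NNReal

/-- The distribution function `d_f(α) = μ {x : |f x| > α}`. -/
noncomputable def distributionFunction {X : Type*} [MeasurableSpace X] (μ : Measure X)
    (f : X → ℝ) (α : ℝ) : ℝ≥0∞ :=
  μ {x | α < |f x|}

/-- The weak `L^p` quasi-norm
`‖f‖_{p,∞} = inf {C > 0 : d_f(α) ≤ C^p / α^p for all α > 0}`, with values in `[0, ∞]`
(the value is `∞` exactly when no finite `C` is admissible). -/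
noncomputable def weakLpNorm {X : Type*} [MeasurableSpace X] (μ : Measure X)
    (p : ℝ) (f : X → ℝ) : ℝ≥0∞ :=
  sInf {C : ℝ≥0∞ | 0 < C ∧
    ∀ α : ℝ, 0 < α → distributionFunction μ f α ≤ C ^ p / ENNReal.ofReal α ^ p}

/-- `f ∈ L^{p,∞}`: `f` is measurable (up to a null set) with finite weak `L^p` quasi-norm. -/
def MemWeakLp {X : Type*} [MeasurableSpace X] (μ : Measure X) (p : ℝ) (f : X → ℝ) : Prop :=
  AEMeasurable f μ ∧ weakLpNorm μ p f < ∞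

/-- The closed cube in `ℝⁿ` with lower corner `a`, side length `l`, and sides parallel to
the coordinate axes. -/
def axisCube {n : ℕ} (a : Fin n → ℝ) (l : ℝ) : Set (Fin n → ℝ) :=
  {x | ∀ i, a i ≤ x i ∧ x i ≤ a i + l}

/-- The BMO seminorm `sup_Q |Q|⁻¹ ∫_Q |f - f_Q|`, where `Q` runs over all cubes with sides
parallel to the axes and `f_Q = |Q|⁻¹ ∫_Q f`, with values in `[0, ∞]`. It is meaningful for locally
integrable `f`. The measure `volume` on `Fin n → ℝ` is Lebesgue measure. -/
noncomputable def bmoSeminorm {n : ℕ} (f : (Fin n → ℝ) → ℝ) : ℝ≥0∞ :=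
  ⨆ (a : Fin n → ℝ) (l : ℝ) (_ : 0 < l),
    ⨍⁻ x in axisCube a l, ENNReal.ofReal |f x - (⨍ y in axisCube a l, f y ∂volume)| ∂volume

/-- `f ∈ BMO(ℝⁿ)`: `f` is locally integrable with finite BMO seminorm. -/
def MemBMO {n : ℕ} (f : (Fin n → ℝ) → ℝ) : Prop :=
  LocallyIntegrable f volume ∧ bmoSeminorm f < ∞

open Filter Topology Metric

/-! Write d for the distribution function of f and let b > 0 bound its BMO seminorm. The core is the
good-λ inequality d(t + 2b + s) ≤ (2·5ⁿ b/s) d(t) of `distributionFunction_add_le`. A stopping-time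
choice of radii and Vitali covering give disjoint balls at least half filled by {|f| > t}, whose
fivefold enlargements are less than half filled. The latter keeps the mean of f on an enlargement
below t + 2b in absolute value, so Chebyshev controls the set where |f| > t + 2b + s there. With s a
large multiple of b the factor becomes 2^(-p), so αᵖ d(α) ≤ (α/2)ᵖ d(α/2) once α ≥ 2Kb. Hence αᵖ
d(α) is controlled by its values for α ≤ 2Kb, where the weak L^q bound suffices. The exponential
decay of John–Nirenberg is not needed. -/

/-- Closed balls of the sup norm are cubes with sides parallel to the axes. -/
lemma axisCube_eq_closedBall {n : ℕ} (x : Fin n → ℝ) {r : ℝ} (hr : 0 ≤ r) :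
    axisCube (fun i => x i - r) (2 * r) = closedBall x r := by
  ext y
  simp only [axisCube, mem_ofPred_eq, mem_closedBall, dist_pi_le_iff hr, Real.dist_eq, abs_le]
  refine forall_congr' fun i => ?_
  constructor <;> rintro ⟨h₁, h₂⟩ <;> constructor <;> linarith

/-- A set of finite measure is covered, up to a null set, by the fivefold enlargements of
countably many disjoint balls, such that the set fills at least half of each ball and less than
half of its enlargement. -/
lemma exists_disjoint_half_density_closedBalls {n : ℕ} (hn : 1 ≤ n) (E : Set (Fin n → ℝ))
    (hE : volume E ≠ ∞) :
    ∃ (u : Set (Fin n → ℝ)) (r : (Fin n → ℝ) → ℝ), u.Countable ∧ (∀ x ∈ u, 0 < r x) ∧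
      (u.PairwiseDisjoint fun x => closedBall x (r x)) ∧
      (∀ x ∈ u, volume (closedBall x (r x)) ≤ 2 * volume (E ∩ closedBall x (r x))) ∧
      (∀ x ∈ u, 2 * volume (E ∩ closedBall x (5 * r x)) < volume (closedBall x (5 * r x))) ∧
      volume (E \ ⋃ x ∈ u, closedBall x (5 * r x)) = 0 := by
  have h5 : ∀ k : ℤ, (0 : ℝ) < 5 ^ k := fun k => by positivity
  let G : Set (Fin n → ℝ) := {x | ∃ k : ℤ,
    volume (closedBall x ((5 : ℝ) ^ k)) ≤ 2 * volume (E ∩ closedBall x ((5 : ℝ) ^ k))}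
  -- At almost every point of E the density is 1, so sufficiently small balls are more than half
  -- filled.
  have hG : volume (E \ G) = 0 := by
    have h := Besicovitch.ae_tendsto_measure_inter_div (volume : Measure (Fin n → ℝ)) E
    have h' : ∀ᵐ x ∂(volume.restrict E), x ∈ G := by
      filter_upwards [h] with x hx
      have hseq : Tendsto (fun m : ℕ => (5 : ℝ) ^ (-(m : ℤ))) atTop (𝓝[>] 0) := by
        refine tendsto_nhdsWithin_iff.2 ⟨?_, Eventually.of_forall fun m => h5 _⟩
        have := tendsto_pow_atTop_nhds_zero_of_lt_one (r := (5 : ℝ)⁻¹) (by norm_num) (by norm_num)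
        simpa using this
      have hev := (hx.comp hseq).eventually
        (eventually_gt_nhds (show (2 : ℝ≥0∞)⁻¹ < 1 by simp))
      obtain ⟨m, hm⟩ := hev.exists
      refine ⟨-(m : ℤ), ?_⟩
      have hpos : volume (closedBall x ((5 : ℝ) ^ (-(m : ℤ)))) ≠ 0 :=
        (measure_closedBall_pos _ _ (h5 _)).ne'
      have hfin : volume (closedBall x ((5 : ℝ) ^ (-(m : ℤ)))) ≠ ∞ :=
        measure_closedBall_lt_top.ne
      have hm' := ((ENNReal.lt_div_iff_mul_lt (Or.inl hpos) (Or.inl hfin)).1 hm).le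
      calc _ = 2 * (2⁻¹ * volume (closedBall x ((5 : ℝ) ^ (-(m : ℤ))))) := by
            rw [← mul_assoc, ENNReal.mul_inv_cancel (by simp) (by simp), one_mul]
        _ ≤ _ := by gcongr
    have h'' := ae_iff.1 h'
    have := Measure.le_restrict_apply E {x | x ∉ G} (μ := volume)
    rw [h''] at this
    refine le_antisymm ((measure_mono ?_).trans this) bot_le
    exact fun x hx => ⟨hx.2, hx.1⟩
  -- A half-filled ball has volume at most 2|E|, which bounds its radius because n ≥ 1.
  obtain ⟨K, hK⟩ : ∃ K : ℤ, ∀ x : Fin n → ℝ, ∀ k : ℤ,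
      volume (closedBall x ((5 : ℝ) ^ k)) ≤ 2 * volume (E ∩ closedBall x ((5 : ℝ) ^ k)) →
      k ≤ K := by
    obtain ⟨m, hm⟩ := pow_unbounded_of_one_lt (2 * (volume E).toReal) (show (1 : ℝ) < 5 by norm_num)
    refine ⟨m, fun x k hk => ?_⟩
    by_contra! hlt
    have hle : volume (closedBall x ((5 : ℝ) ^ k)) ≤ 2 * volume E :=
      hk.trans (by gcongr; exact inter_subset_left)
    rw [Real.volume_pi_closedBall x (h5 k).le, Fintype.card_fin] at hle
    have h2 : ENNReal.ofReal ((2 * (5 : ℝ) ^ k) ^ n) ≤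
        ENNReal.ofReal (2 * (volume E).toReal) := by
      rwa [ENNReal.ofReal_mul (by norm_num : (0 : ℝ) ≤ 2), ENNReal.ofReal_toReal hE,
        ENNReal.ofReal_ofNat]
    have h3 := (ENNReal.ofReal_le_ofReal_iff (by positivity)).1 h2
    have h4 : (5 : ℝ) ^ m ≤ 5 ^ k := by
      rw [← zpow_natCast]
      exact zpow_le_zpow_right₀ (by norm_num) hlt.le
    have h6 : (1 : ℝ) ≤ 5 ^ m := one_le_pow₀ (by norm_num)
    have h7 : 2 * (5 : ℝ) ^ k ≤ (2 * (5 : ℝ) ^ k) ^ n :=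
      le_self_pow₀ (by linarith) (by omega)
    linarith
  have hmax : ∀ x ∈ G, ∃ k : ℤ,
      volume (closedBall x ((5 : ℝ) ^ k)) ≤ 2 * volume (E ∩ closedBall x ((5 : ℝ) ^ k)) ∧
      ∀ j : ℤ, volume (closedBall x ((5 : ℝ) ^ j)) ≤ 2 * volume (E ∩ closedBall x ((5 : ℝ) ^ j)) →
        j ≤ k := fun x hx => Int.exists_greatest_of_bdd ⟨K, hK x⟩ hx
  choose! κ hκ hκmax using hmax
  obtain ⟨u, hu, hdisj, hcov⟩ := Vitali.exists_disjoint_subfamily_covering_enlargement_closedBall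
    G (fun x => x) (fun x => (5 : ℝ) ^ κ x) (5 ^ K)
    (fun x hx => zpow_le_zpow_right₀ (by norm_num) (hK x _ (hκ x hx))) 5 (by norm_num)
  refine ⟨u, fun x => 5 ^ κ x, ?_, fun x _ => h5 _, hdisj, fun x hx => hκ x (hu hx), ?_, ?_⟩
  · refine hdisj.countable_of_nonempty_interior fun x _ => ?_
    exact (nonempty_ball.2 (h5 (κ x))).mono ball_subset_interior_closedBall
  -- Radii are powers of 5 so that the Vitali enlargement is the next candidate radius, excluded by
  -- maximality of `κ x`.
  · intro x hx
    by_contra! hle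
    have h51 : (5 : ℝ) * 5 ^ κ x = 5 ^ (κ x + 1) := by
      rw [zpow_add_one₀ (by norm_num), mul_comm]
    rw [h51] at hle
    have := hκmax x (hu hx) _ hle
    omega
  · refine measure_mono_null (t := E \ G) ?_ hG
    refine fun x hx => ⟨hx.1, fun hxG => hx.2 ?_⟩
    obtain ⟨y, hy, hxy⟩ := hcov x hxG
    exact mem_biUnion hy (hxy (mem_closedBall_self (h5 _).le))

/-- Chebyshev's inequality for the oscillation of a function on a ball. -/
lemma exists_measure_inter_closedBall_le {n : ℕ} {f : (Fin n → ℝ) → ℝ}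
    (hf : AEMeasurable f volume) {b : ℝ} (hb : bmoSeminorm f ≤ ENNReal.ofReal b)
    (x : Fin n → ℝ) {r : ℝ} (hr : 0 < r) :
    ∃ m : ℝ, ∀ s : ℝ, 0 < s → volume ({y | s ≤ |f y - m|} ∩ closedBall x r) ≤
      ENNReal.ofReal (b / s) * volume (closedBall x r) := by
  refine ⟨⨍ y in closedBall x r, f y, fun s hs => ?_⟩
  set m := ⨍ y in closedBall x r, f y
  have h : ⨍⁻ y in closedBall x r, ENNReal.ofReal |f y - m| ∂volume ≤ ENNReal.ofReal b := by
    refine le_trans ?_ hb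
    have := le_iSup₂_of_le (f := fun (a : Fin n → ℝ) (l : ℝ) => ⨆ _ : 0 < l,
      ⨍⁻ x in axisCube a l, ENNReal.ofReal |f x - (⨍ y in axisCube a l, f y)| ∂volume)
      (fun i => x i - r) (2 * r) (le_iSup_of_le (by positivity) le_rfl)
    rwa [axisCube_eq_closedBall x hr.le] at this
  have hpos : volume (closedBall x r) ≠ 0 := (measure_closedBall_pos _ _ hr).ne'
  have hfin : volume (closedBall x r) ≠ ∞ := measure_closedBall_lt_top.ne
  rw [setLAverage_eq, ENNReal.div_le_iff hpos hfin] at h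
  have hmeas : AEMeasurable (fun y => ENNReal.ofReal |f y - m|)
      (volume.restrict (closedBall x r)) := by
    have := hf.restrict (s := closedBall x r)
    fun_prop
  have hch := meas_ge_le_lintegral_div hmeas (ε := ENNReal.ofReal s) (by simpa using hs) (by simp)
  rw [Measure.restrict_apply' measurableSet_closedBall] at hch
  have hset : {y | ENNReal.ofReal s ≤ ENNReal.ofReal |f y - m|} = {y | s ≤ |f y - m|} := by
    ext y
    exact ENNReal.ofReal_le_ofReal_iff (abs_nonneg _)
  rw [hset] at hch
  refine hch.trans ?_
  rw [ENNReal.ofReal_div_of_pos hs]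
  calc _ ≤ ENNReal.ofReal b * volume (closedBall x r) / ENNReal.ofReal s := by gcongr
    _ = _ := by simp only [div_eq_mul_inv]; ring

/-- Good-`λ` inequality for functions of bounded mean oscillation. -/
lemma distributionFunction_add_le {n : ℕ} (hn : 1 ≤ n) {f : (Fin n → ℝ) → ℝ}
    (hf : AEMeasurable f volume) {b : ℝ} (hb0 : 0 < b) (hb : bmoSeminorm f ≤ ENNReal.ofReal b)
    {s t : ℝ} (hs : 0 < s) (ht : distributionFunction volume f t ≠ ∞) :
    distributionFunction volume f (t + 2 * b + s) ≤
      ENNReal.ofReal (b / s * 5 ^ n * 2) * distributionFunction volume f t := by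
  set E := {x | t < |f x|} with hEdef
  set F := {x | t + 2 * b + s < |f x|} with hFdef
  change volume F ≤ _ * volume E
  obtain ⟨u, r, hu, hr, hdisj, hhalf, hsmall, hnull⟩ :=
    exists_disjoint_half_density_closedBalls hn E ht
  have key : ∀ x ∈ u, volume (F ∩ closedBall x (5 * r x)) ≤
      ENNReal.ofReal (b / s * 5 ^ n * 2) * volume (E ∩ closedBall x (r x)) := by
    intro x hx
    have hr5 : 0 < 5 * r x := by linarith [hr x hx]
    obtain ⟨m, hm⟩ := exists_measure_inter_closedBall_le hf hb x hr5
    set B := closedBall x (5 * r x)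
    have hBfin : volume B ≠ ∞ := measure_closedBall_lt_top.ne
    -- Otherwise |f - m| ≥ 2b on B outside E. By Chebyshev that fills at most half of B, while E
    -- fills less than half.
    have hmt : |m| ≤ t + 2 * b := by
      by_contra! hlt
      have hsub : B ⊆ (E ∩ B) ∪ ({y | 2 * b ≤ |f y - m|} ∩ B) := by
        intro y hy
        by_cases hyE : t < |f y|
        · exact Or.inl ⟨hyE, hy⟩
        · refine Or.inr ⟨?_, hy⟩
          have := abs_sub_abs_le_abs_sub m (f y)
          rw [abs_sub_comm] at this
          rw [mem_ofPred_eq]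
          linarith
      have h1 := (measure_mono hsub).trans (measure_union_le (μ := volume) _ _)
      have h2 := hm (2 * b) (by linarith)
      rw [show b / (2 * b) = (2 : ℝ)⁻¹ by field_simp,
        ENNReal.ofReal_inv_of_pos (by norm_num), ENNReal.ofReal_ofNat] at h2
      have h3 : 2 * volume B ≤ 2 * volume (E ∩ B) + volume B := by
        calc 2 * volume B ≤ 2 * (volume (E ∩ B) + 2⁻¹ * volume B) := by
              gcongr; exact h1.trans (by gcongr)
          _ = _ := by
              rw [mul_add, ← mul_assoc, ENNReal.mul_inv_cancel (by simp) (by simp), one_mul]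
      rw [two_mul (volume B)] at h3
      exact absurd ((ENNReal.add_le_add_iff_right hBfin).1 h3) (hsmall x hx).not_ge
    calc volume (F ∩ B) ≤ volume ({y | s ≤ |f y - m|} ∩ B) := by
          refine measure_mono (inter_subset_inter_left _ fun y hy => ?_)
          have := abs_sub_abs_le_abs_sub (f y) m
          rw [hFdef, mem_ofPred_eq] at hy
          rw [mem_ofPred_eq]
          linarith
      _ ≤ ENNReal.ofReal (b / s) * volume B := hm s hs
      _ = ENNReal.ofReal (b / s) * (ENNReal.ofReal (5 ^ n) * volume (closedBall x (r x))) := by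
          congr 1
          rw [Real.volume_pi_closedBall x hr5.le, Real.volume_pi_closedBall x (hr x hx).le,
            ← ENNReal.ofReal_mul (by positivity), Fintype.card_fin, ← mul_pow]
          congr 2; ring
      _ ≤ ENNReal.ofReal (b / s) *
          (ENNReal.ofReal (5 ^ n) * (2 * volume (E ∩ closedBall x (r x)))) := by
          gcongr; exact hhalf x hx
      _ = _ := by
          rw [ENNReal.ofReal_mul (by positivity), ENNReal.ofReal_mul (by positivity),
            ENNReal.ofReal_ofNat]
          ring
  have hFE : F ⊆ E := fun y hy => by
    rw [hFdef, mem_ofPred_eq] at hy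
    rw [hEdef, mem_ofPred_eq]
    linarith
  have hFcov : F ⊆ (E \ ⋃ x ∈ u, closedBall x (5 * r x)) ∪
      ⋃ x ∈ u, F ∩ closedBall x (5 * r x) := by
    intro y hy
    by_cases h : y ∈ ⋃ x ∈ u, closedBall x (5 * r x)
    · right
      simp only [mem_iUnion, exists_prop, mem_inter_iff] at h ⊢
      obtain ⟨x, hx, hxy⟩ := h
      exact ⟨x, hx, hy, hxy⟩
    · exact Or.inl ⟨hFE hy, h⟩
  have hsum : ∑' x : u, volume (E ∩ closedBall (x : Fin n → ℝ) (r x)) ≤ volume E := by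
    -- Restricting the measure to E gives additivity over the balls without measurability of E.
    have h := measure_biUnion (μ := volume.restrict E) hu hdisj
      fun x _ => measurableSet_closedBall
    simp only [Measure.restrict_apply measurableSet_closedBall, inter_comm _ E] at h
    rw [← h]
    exact (measure_mono (subset_univ _)).trans (by simp)
  calc volume F ≤ volume (E \ ⋃ x ∈ u, closedBall x (5 * r x)) +
        volume (⋃ x ∈ u, F ∩ closedBall x (5 * r x)) :=
        (measure_mono hFcov).trans (measure_union_le _ _)
    _ = volume (⋃ x ∈ u, F ∩ closedBall x (5 * r x)) := by rw [hnull, zero_add]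
    _ ≤ ∑' x : u, volume (F ∩ closedBall (x : Fin n → ℝ) (5 * r x)) := measure_biUnion_le _ hu _
    _ ≤ ∑' x : u, ENNReal.ofReal (b / s * 5 ^ n * 2) *
        volume (E ∩ closedBall (x : Fin n → ℝ) (r x)) :=
        ENNReal.tsum_le_tsum fun x => key x x.2
    _ = ENNReal.ofReal (b / s * 5 ^ n * 2) *
        ∑' x : u, volume (E ∩ closedBall (x : Fin n → ℝ) (r x)) := ENNReal.tsum_mul_left
    _ ≤ _ := by gcongr

lemma distributionFunction_anti {X : Type*} [MeasurableSpace X] (μ : Measure X) (f : X → ℝ) :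
    Antitone (distributionFunction μ f) :=
  fun _ _ h => measure_mono fun _ hx => lt_of_le_of_lt h hx

/-- Strict inequality provides an admissible constant below A, so attainment of the infimum is not
needed. -/
lemma rpow_mul_distributionFunction_le_of_weakLpNorm_lt {X : Type*} [MeasurableSpace X]
    {μ : Measure X} {q : ℝ} (hq : 0 < q) {f : X → ℝ} {A : ℝ≥0∞} (hA : weakLpNorm μ q f < A)
    {α : ℝ} (hα : 0 < α) : ENNReal.ofReal α ^ q * distributionFunction μ f α ≤ A ^ q := by
  obtain ⟨C, ⟨-, hC⟩, hCA⟩ := sInf_lt_iff.1 hA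
  have h0 : ENNReal.ofReal α ^ q ≠ 0 := by simp [ENNReal.rpow_eq_zero_iff, hα]
  have htop : ENNReal.ofReal α ^ q ≠ ∞ := ENNReal.rpow_ne_top_of_nonneg hq.le ENNReal.ofReal_ne_top
  rw [mul_comm, ← ENNReal.le_div_iff_mul_le (Or.inl h0) (Or.inl htop)]
  exact (hC α hα).trans (by gcongr)

/-- The weak `L^p` bound obtained by iterating the good-`λ` inequality from height `t` to `2t`. -/
lemma rpow_mul_distributionFunction_le {n : ℕ} (hn : 1 ≤ n) {q p : ℝ} (hq : 0 < q) (hqp : q < p)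
    {f : (Fin n → ℝ) → ℝ} (hf : AEMeasurable f volume) {A : ℝ≥0∞} (hA : A ≠ ∞)
    (hAq : ∀ α : ℝ, 0 < α → ENNReal.ofReal α ^ q * distributionFunction volume f α ≤ A ^ q)
    {b : ℝ} (hb0 : 0 < b) (hb : bmoSeminorm f ≤ ENNReal.ofReal b) {α : ℝ} (hα : 0 < α) :
    ENNReal.ofReal α ^ p * distributionFunction volume f α ≤
      A ^ q * ENNReal.ofReal (2 * (2 + 5 ^ n * 2 * 2 ^ p) * b) ^ (p - q) := by
  have hp : 0 < p := hq.trans hqp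
  have h2p : (0 : ℝ) < 2 ^ p := by positivity
  set K : ℝ := 2 + 5 ^ n * 2 * 2 ^ p with hK
  have hK0 : 0 < K := by positivity
  have main : ∀ k : ℕ, ∀ α : ℝ, 0 < α → α ≤ 2 * K * b * 2 ^ k →
      ENNReal.ofReal α ^ p * distributionFunction volume f α ≤
        A ^ q * ENNReal.ofReal (2 * K * b) ^ (p - q) := by
    intro k
    induction k with
    | zero =>
      intro α hα hle
      have hsplit : ENNReal.ofReal α ^ p = ENNReal.ofReal α ^ (p - q) * ENNReal.ofReal α ^ q := by
        rw [← ENNReal.rpow_add _ _ (by simpa using hα) ENNReal.ofReal_ne_top, sub_add_cancel]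
      rw [hsplit, mul_assoc, mul_comm (A ^ q)]
      have hpq : 0 ≤ p - q := by linarith
      have hle' : α ≤ 2 * K * b := by simpa using hle
      gcongr
      exact hAq α hα
    | succ k ih =>
      intro α hα hle
      by_cases hsmall : α ≤ 2 * K * b * 2 ^ k
      · exact ih α hα hsmall
      -- This gives Kb ≤ α/2, so the good-λ step from α/2 lands at a height at most α.
      have hbig : 2 * K * b ≤ α := by
        have : (1 : ℝ) ≤ 2 ^ k := one_le_pow₀ (by norm_num)
        have h0 : 0 < 2 * K * b := by positivity
        nlinarith
      have ht0 : 0 < α / 2 := by linarith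
      refine le_trans ?_ (ih (α / 2) ht0 (by rw [pow_succ] at hle; linarith))
      have hfin : distributionFunction volume f (α / 2) ≠ ∞ := by
        intro htop
        have h := hAq _ ht0
        rw [htop, ENNReal.mul_top (by simp [ENNReal.rpow_eq_zero_iff, hα])] at h
        exact ENNReal.rpow_ne_top_of_nonneg hq.le hA (top_le_iff.1 h)
      -- This s makes the good-λ factor exactly 2^(-p).
      have hgood := distributionFunction_add_le hn hf hb0 hb
        (s := b * (5 ^ n * 2 * 2 ^ p)) (by positivity) hfin
      have hcoef : b / (b * (5 ^ n * 2 * 2 ^ p)) * 5 ^ n * 2 = ((2 : ℝ) ^ p)⁻¹ := by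
        field_simp
      rw [hcoef] at hgood
      have hanti : distributionFunction volume f α ≤
          distributionFunction volume f (α / 2 + 2 * b + b * (5 ^ n * 2 * 2 ^ p)) := by
        refine distributionFunction_anti _ _ ?_
        have : 2 * b + b * (5 ^ n * 2 * 2 ^ p) = K * b := by rw [hK]; ring
        linarith
      have hscale : ENNReal.ofReal α ^ p * ENNReal.ofReal ((2 : ℝ) ^ p)⁻¹ =
          ENNReal.ofReal (α / 2) ^ p := by
        rw [ENNReal.ofReal_rpow_of_pos hα, ENNReal.ofReal_rpow_of_pos ht0,
          ← ENNReal.ofReal_mul (by positivity), Real.div_rpow hα.le (by norm_num), div_eq_mul_inv]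
      calc _ ≤ ENNReal.ofReal α ^ p * (ENNReal.ofReal ((2 : ℝ) ^ p)⁻¹ *
            distributionFunction volume f (α / 2)) := by
            gcongr; exact hanti.trans hgood
        _ = _ := by rw [← mul_assoc, hscale]
  obtain ⟨k, hk⟩ := pow_unbounded_of_one_lt (α / (2 * K * b)) (one_lt_two : (1 : ℝ) < 2)
  refine main k α hα ?_
  rw [div_lt_iff₀ (by positivity)] at hk
  linarith

theorem mainTheorem3 (n : ℕ) (hn : 1 ≤ n) (q p : ℝ) (hq : 1 ≤ q) (hqp : q < p) :
    ∃ c : ℝ≥0, ∀ f : (Fin n → ℝ) → ℝ, MemWeakLp volume q f → MemBMO f →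
      MemWeakLp volume p f ∧
        weakLpNorm volume p f ≤
          (c : ℝ≥0∞) * weakLpNorm volume q f ^ (q / p) * bmoSeminorm f ^ (1 - q / p) := by
  have hq0 : 0 < q := by linarith
  have hp : 0 < p := by linarith
  have hqp0 : 0 ≤ q / p := by positivity
  have hqp1 : 0 ≤ 1 - q / p := by
    rw [sub_nonneg, div_le_one hp]; exact hqp.le
  set L : ℝ := 2 * (2 + 5 ^ n * 2 * 2 ^ p) with hL
  have hL0 : 0 < L := by positivity
  have hc : ENNReal.ofReal L ^ (1 - q / p) ≠ ∞ :=
    ENNReal.rpow_ne_top_of_nonneg hqp1 ENNReal.ofReal_ne_top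
  refine ⟨(ENNReal.ofReal L ^ (1 - q / p)).toNNReal, fun f hfq hfb => ?_⟩
  rw [ENNReal.coe_toNNReal hc]
  have hA := hfq.2
  have hB := hfb.2
  -- The ε supplies a strict bound on the weak norm and a positive b even when the seminorm
  -- vanishes.
  have bound : ∀ ε : ℝ, 0 < ε → weakLpNorm volume p f ≤ ENNReal.ofReal L ^ (1 - q / p) *
      (weakLpNorm volume q f + ENNReal.ofReal ε) ^ (q / p) *
      (bmoSeminorm f + ENNReal.ofReal ε) ^ (1 - q / p) := by
    intro ε hε
    have hε' : ENNReal.ofReal ε ≠ 0 := by simpa using hε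
    have hAlt : weakLpNorm volume q f < weakLpNorm volume q f + ENNReal.ofReal ε :=
      ENNReal.lt_add_right hA.ne hε'
    have hAtop : weakLpNorm volume q f + ENNReal.ofReal ε ≠ ∞ := by simp [hA.ne]
    set A := weakLpNorm volume q f + ENNReal.ofReal ε
    have hb0 : 0 < (bmoSeminorm f).toReal + ε := by positivity
    have hbeq : ENNReal.ofReal ((bmoSeminorm f).toReal + ε) = bmoSeminorm f + ENNReal.ofReal ε := by
      rw [ENNReal.ofReal_add (by positivity) hε.le, ENNReal.ofReal_toReal hB.ne]
    have hb : bmoSeminorm f ≤ ENNReal.ofReal ((bmoSeminorm f).toReal + ε) := by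
      rw [hbeq]; exact le_self_add
    rw [← hbeq]
    set b := (bmoSeminorm f).toReal + ε
    refine sInf_le ⟨?_, fun α hα => ?_⟩
    · have h1 := ENNReal.rpow_pos (p := 1 - q / p) (ENNReal.ofReal_pos.2 hL0) ENNReal.ofReal_ne_top
      have h2 := ENNReal.rpow_pos (p := q / p) (bot_le.trans_lt hAlt) hAtop
      have h3 := ENNReal.rpow_pos (p := 1 - q / p) (ENNReal.ofReal_pos.2 hb0) ENNReal.ofReal_ne_top
      exact ENNReal.mul_pos (ENNReal.mul_pos h1.ne' h2.ne').ne' h3.ne'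
    · have h0 : ENNReal.ofReal α ^ p ≠ 0 := by simp [ENNReal.rpow_eq_zero_iff, hα]
      have htop : ENNReal.ofReal α ^ p ≠ ∞ :=
        ENNReal.rpow_ne_top_of_nonneg hp.le ENNReal.ofReal_ne_top
      rw [ENNReal.le_div_iff_mul_le (Or.inl h0) (Or.inl htop), mul_comm]
      refine (rpow_mul_distributionFunction_le hn hq0 hqp hfq.1 hAtop
        (fun β hβ => rpow_mul_distributionFunction_le_of_weakLpNorm_lt hq0 hAlt hβ)
        hb0 hb hα).trans_eq ?_
      have e1 : (1 - q / p) * p = p - q := by field_simp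
      have e2 : q / p * p = q := by field_simp
      rw [ENNReal.mul_rpow_of_nonneg _ _ hp.le, ENNReal.mul_rpow_of_nonneg _ _ hp.le,
        ← ENNReal.rpow_mul, ← ENNReal.rpow_mul, ← ENNReal.rpow_mul, e1, e2, ← hL,
        ENNReal.ofReal_mul hL0.le, ENNReal.mul_rpow_of_nonneg _ _ (by linarith)]
      ring
  have hle : weakLpNorm volume p f ≤ ENNReal.ofReal L ^ (1 - q / p) *
      weakLpNorm volume q f ^ (q / p) * bmoSeminorm f ^ (1 - q / p) := by
    have hlim : ∀ (a : ℝ≥0∞) (e : ℝ), Tendsto (fun ε : ℝ => (a + ENNReal.ofReal ε) ^ e)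
        (𝓝[>] 0) (𝓝 (a ^ e)) := by
      intro a e
      have hcont : Continuous fun ε : ℝ => (a + ENNReal.ofReal ε) ^ e :=
        ENNReal.continuous_rpow_const.comp
          (continuous_const.add ENNReal.continuous_ofReal)
      have := hcont.tendsto 0
      simp only [ENNReal.ofReal_zero, add_zero] at this
      exact this.mono_left nhdsWithin_le_nhds
    -- Finite factors make multiplication in `ℝ≥0∞` continuous even where another factor tends to 0.
    have hAtop := ENNReal.rpow_ne_top_of_nonneg hqp0 hA.ne
    have hBtop := ENNReal.rpow_ne_top_of_nonneg hqp1 hB.ne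
    refine ge_of_tendsto (ENNReal.Tendsto.mul
      (ENNReal.Tendsto.const_mul (hlim (weakLpNorm volume q f) (q / p)) (Or.inr hc))
      (Or.inr hBtop) (hlim (bmoSeminorm f) (1 - q / p)) (Or.inr (ENNReal.mul_ne_top hc hAtop))) ?_
    filter_upwards [self_mem_nhdsWithin] with ε hε using bound ε hε
  refine ⟨⟨hfq.1, hle.trans_lt ?_⟩, hle⟩
  exact ENNReal.mul_lt_top (ENNReal.mul_lt_top hc.lt_top
    (ENNReal.rpow_lt_top_of_nonneg hqp0 hA.ne)) (ENNReal.rpow_lt_top_of_nonneg hqp1 hB.ne)
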